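/- **Theorem.** Let $\Bbbk$ be a commutative ring and let $(L,\circ)$ be a (right) pre-Lie algebra over $\Bbbk$, i.e. a $\Bbbk$-module with a bilinear product satisfying $X\circ(Y\circ Z)-(X\circ Y)\circ Z = X\circ(Z\circ Y)-(X\circ Z)\circ Y$. Let $L_{Lie}$ be the Lie algebra $L$ with bracket $[X,Y]=X\circ Y-Y\circ X$. Let $S(L)$ be the symmetric algebra of $L$ with its usual coproduct $\Delta(A)=A_{(1)}\otimes A_{(2)}$ (the algebra morphism for which the elements of $L$ are primitive) and counit $\varepsilon$. Extend $\circ$ to the bilinear product on $S(L)$ determined by $$A\circ 1=A,\qquad T\circ (BX)=(T\circ B)\circ X-T\circ(B\circ X),\qquad (AB)\circ C=(A\circ C_{(1)})(B\circ C_{(2)})$$ for $A,B,C\in S(L)$ and $T,X\in L$, and put $A*B:=(A\circ B_{(1)})B_{(2)}$. Then $(S(L),*,\Delta)$, with unit $1$ and counit $\varepsilon$, is a Hopf algebra, and it is isomorphic as a Hopf algebra to the universal enveloping algebra $\mathcal U(L_{Lie})$ (with its usual Hopf algebra structure, in which the elements of $L$ are primitive), by an isomorphism $\mathcal U(L_{Lie})\to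 S(L)$ that restricts to the identity on $L$. -/

import Mathlib

open scoped TensorProduct

noncomputable section

namespace PreLieSym

/-! ### Linear maps out of a symmetric algebra -/

section Symmetric

variable {R L N : Type*} [CommRing R] [AddCommGroup L] [Module R L] [AddCommGroup N] [Module R N]

/-- A submodule of the symmetric algebra that contains `1` and is stable under multiplication by
generators is everything. -/
theorem submodule_eq_top (V : Submodule R (SymmetricAlgebra R L)) (h1 : 1 ∈ V)
    (hx : ∀ (x : L) (B : SymmetricAlgebra R L), B ∈ V → SymmetricAlgebra.ι R L x * B ∈ V)
    (A : SymmetricAlgebra R L) : A ∈ V := by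
  have key : ∀ A : SymmetricAlgebra R L, ∀ B ∈ V, A * B ∈ V := by
    intro A
    induction A using SymmetricAlgebra.induction with
    | algebraMap r => intro B hB; rw [← Algebra.smul_def]; exact V.smul_mem r hB
    | ι x => exact hx x
    | mul a b ha hb => intro B hB; rw [mul_assoc]; exact ha _ (hb _ hB)
    | add a b ha hb => intro B hB; rw [add_mul]; exact V.add_mem (ha _ hB) (hb _ hB)
  simpa using key A 1 h1

/-- There is a linear map `f` on the symmetric algebra with `f 1 = c` and `f (x B) = g x B`,
provided that `g x (y B) = g y (x B)`. -/
theorem exists_rec (c : N) (g : L →ₗ[R] SymmetricAlgebra R L →ₗ[R] N)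
    (hg : ∀ x y B, g x (SymmetricAlgebra.ι R L y * B) = g y (SymmetricAlgebra.ι R L x * B)) :
    ∃ f : SymmetricAlgebra R L →ₗ[R] N, f 1 = c ∧
      ∀ x B, f (SymmetricAlgebra.ι R L x * B) = g x B := by
  let S := SymmetricAlgebra R L
  let op : L →ₗ[R] Module.End R (S × N) :=
    { toFun := fun x => ((LinearMap.mulLeft R (SymmetricAlgebra.ι R L x)).prod (g x)).comp
        (LinearMap.fst R S N)
      map_add' := fun x y => by
        ext p <;> simp [S, add_mul]
      map_smul' := fun r x => by
        ext p <;> simp [S] }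
  have hop : ∀ x p, op x p = (SymmetricAlgebra.ι R L x * p.1, g x p.1) := fun x p => rfl
  have hcomm : ∀ a ∈ Set.range op, ∀ b ∈ Set.range op, a * b = b * a := by
    rintro _ ⟨x, rfl⟩ _ ⟨y, rfl⟩
    refine LinearMap.ext fun p => ?_
    simp only [Module.End.mul_apply, hop, Prod.mk.injEq]
    exact ⟨mul_left_comm _ _ _, hg _ _ _⟩
  have := Algebra.isMulCommutative_adjoin R hcomm
  let _ : CommSemiring (Algebra.adjoin R (Set.range op)) :=
    { (Algebra.adjoin R (Set.range op)).toSemiring with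
      mul_comm := fun a b => mul_comm' a b }
  let op' : L →ₗ[R] Algebra.adjoin R (Set.range op) :=
    op.codRestrict (Subalgebra.toSubmodule (Algebra.adjoin R (Set.range op)))
      (fun x => Algebra.subset_adjoin ⟨x, rfl⟩)
  let Φ : S →ₐ[R] Module.End R (S × N) :=
    (Algebra.adjoin R (Set.range op)).val.comp (SymmetricAlgebra.lift op')
  have hΦ : ∀ x, Φ (SymmetricAlgebra.ι R L x) = op x := by
    intro x
    exact congr(Subtype.val $(SymmetricAlgebra.lift_ι_apply op' x))
  have hfst : ∀ A : S, (Φ A (1, c)).1 = A := by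
    intro A
    have key : ∀ A : S, ∀ p, (Φ A p).1 = A * p.1 := by
      intro A
      induction A using SymmetricAlgebra.induction with
      | algebraMap r => intro p; rw [AlgHom.commutes]; simp [Algebra.smul_def]; rfl
      | ι x => intro p; rw [hΦ, hop]
      | mul a b ha hb => intro p; rw [map_mul, Module.End.mul_apply, ha, hb, mul_assoc]
      | add a b ha hb => intro p; rw [map_add, LinearMap.add_apply, Prod.fst_add, ha, hb, add_mul]
    rw [key, mul_one]
  refine ⟨(LinearMap.snd R S N).comp ((LinearMap.applyₗ ((1 : S), c)).comp Φ.toLinearMap), ?_, ?_⟩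
  · simp
  · intro x B
    change (Φ (SymmetricAlgebra.ι R L x * B) (1, c)).2 = g x B
    rw [map_mul, Module.End.mul_apply, hΦ, hop, hfst]

/-- Two derivations of the symmetric algebra that agree on generators are equal. -/
theorem derivation_ext {d₁ d₂ : Derivation R (SymmetricAlgebra R L) (SymmetricAlgebra R L)}
    (h : ∀ x, d₁ (SymmetricAlgebra.ι R L x) = d₂ (SymmetricAlgebra.ι R L x)) : d₁ = d₂ := by
  ext A
  induction A using SymmetricAlgebra.induction with
  | algebraMap r => simp
  | ι x => exact h x
  | mul a b ha hb => simp [ha, hb]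
  | add a b ha hb => simp [ha, hb]

/-- A linear endomorphism `f` of `L` extends to a derivation of the symmetric algebra:
`x₁ ⋯ xₙ ↦ ∑ᵢ x₁ ⋯ f xᵢ ⋯ xₙ`. It is read off from the algebra morphism
`x ↦ x + f x • ε` to the dual numbers. -/
def derivationLift (f : L →ₗ[R] L) :
    Derivation R (SymmetricAlgebra R L) (SymmetricAlgebra R L) :=
  let Ψ : SymmetricAlgebra R L →ₐ[R] DualNumber (SymmetricAlgebra R L) :=
    SymmetricAlgebra.lift
      ((TrivSqZeroExt.inlAlgHom R (SymmetricAlgebra R L) (SymmetricAlgebra R L)).toLinearMap ∘ₗ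
          SymmetricAlgebra.ι R L +
        (TrivSqZeroExt.inrHom (SymmetricAlgebra R L) (SymmetricAlgebra R L)).restrictScalars R ∘ₗ
          SymmetricAlgebra.ι R L ∘ₗ f)
  have hfst : ∀ A, (Ψ A).fst = A := fun A => by
    have : (TrivSqZeroExt.fstHom R (SymmetricAlgebra R L) (SymmetricAlgebra R L)).comp Ψ =
        AlgHom.id R _ := by
      ext x; simp [Ψ]
    exact congr($this A)
  Derivation.mk'
    ((TrivSqZeroExt.sndHom (SymmetricAlgebra R L) (SymmetricAlgebra R L)).restrictScalars R ∘ₗ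
      Ψ.toLinearMap)
    (fun a b => by simp [hfst, mul_comm b])

@[simp]
theorem derivationLift_ι (f : L →ₗ[R] L) (x : L) :
    derivationLift f (SymmetricAlgebra.ι R L x) = SymmetricAlgebra.ι R L (f x) := by
  simp [derivationLift]

end Symmetric

/-! ### The product `∘` on the symmetric algebra of a pre-Lie algebra

The pre-Lie product of `L` is written `x * y`. -/

section Circ

variable (R L : Type*) [CommRing R] [RightPreLieRing L] [RightPreLieAlgebra R L]

/-- The right action of `L` on `S(L)`, `rightAct X A = A ∘ X`:
`1 ∘ X = 0` and `(X₁ ⋯ Xₙ) ∘ X = ∑ᵢ X₁ ⋯ (Xᵢ ∘ X) ⋯ Xₙ`. -/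
def rightAct : L →ₗ[R] Derivation R (SymmetricAlgebra R L) (SymmetricAlgebra R L) where
  toFun x := derivationLift (LinearMap.mulRight R x)
  map_add' x y := derivation_ext fun z => by simp [mul_add]
  map_smul' r x := derivation_ext fun z => by simp [mul_smul_comm]

@[simp]
theorem rightAct_ι (x z : L) :
    rightAct R L x (SymmetricAlgebra.ι R L z) = SymmetricAlgebra.ι R L (z * x) := by
  simp [rightAct]

/-- The action is right symmetric: `(A ∘ X) ∘ Y - A ∘ (X ∘ Y)` is symmetric in `X` and `Y`. -/
theorem rightAct_symm (x y : L) (A : SymmetricAlgebra R L) :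
    rightAct R L y (rightAct R L x A) - rightAct R L (x * y) A =
      rightAct R L x (rightAct R L y A) - rightAct R L (y * x) A := by
  have h : ⁅rightAct R L y, rightAct R L x⁆ = rightAct R L (x * y) - rightAct R L (y * x) := by
    refine derivation_ext fun z => ?_
    have := RightPreLieRing.assoc_symm z x y
    simp only [associator_apply] at this
    simp only [Derivation.commutator_apply, rightAct_ι, ← map_sub]
    congr 1
    rw [mul_sub, ← sub_eq_zero]
    rw [← sub_eq_zero] at this
    rw [← this]
    abel
  have h' := congr($h A)
  simp only [Derivation.commutator_apply, Derivation.sub_apply] at h'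
  rw [sub_eq_sub_iff_sub_eq_sub]
  exact h'

/-- `(X, B) ↦ (T ↦ (f B T) ∘ X - f (B ∘ X) T)`, the right-hand side of the recursion
`T ∘ BX = (T ∘ B) ∘ X - T ∘ (B ∘ X)`. -/
def circStep (f : SymmetricAlgebra R L →ₗ[R] L →ₗ[R] L) :
    L →ₗ[R] SymmetricAlgebra R L →ₗ[R] L →ₗ[R] L where
  toFun x := (LinearMap.llcomp R L L L (LinearMap.mulRight R x)) ∘ₗ f -
    f ∘ₗ (rightAct R L x).toLinearMap
  map_add' x y := by
    ext B T; simp [mul_add]; abel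
  map_smul' r x := by
    ext B T; simp [smul_sub, mul_smul_comm]

variable {R L} in
theorem circStep_apply (f : SymmetricAlgebra R L →ₗ[R] L →ₗ[R] L) (x : L)
    (B : SymmetricAlgebra R L) (T : L) :
    circStep R L f x B T = f B T * x - f (rightAct R L x B) T := rfl

/-- The condition under which `BX ↦ circStep f X B` does not depend on the order of the letters. -/
def Admissible (f : SymmetricAlgebra R L →ₗ[R] L →ₗ[R] L) : Prop :=
  ∀ x y B, circStep R L f x (SymmetricAlgebra.ι R L y * B) =
    circStep R L f y (SymmetricAlgebra.ι R L x * B)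

variable {R L} in
theorem admissible_of_step {f f' : SymmetricAlgebra R L →ₗ[R] L →ₗ[R] L}
    (h : ∀ x B, f' (SymmetricAlgebra.ι R L x * B) = circStep R L f x B) :
    Admissible R L f' := by
  intro x y B
  ext T
  have hs := congr(f $(rightAct_symm R L x y B) T)
  have ha := RightPreLieRing.assoc_symm (f B T) x y
  simp only [associator_apply] at ha
  simp only [map_sub, LinearMap.sub_apply] at hs
  simp only [circStep_apply, h, Derivation.leibniz, rightAct_ι, smul_eq_mul, map_add,
    LinearMap.add_apply, sub_mul, mul_comm B]
  grind

/-- The operations `T ∘₍ₙ₎ A`, as `circN n A T`, extended by zero to the `A` of length other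
than `n`: `T ∘₍₀₎ 1 = T` and `T ∘₍ₙ₊₁₎ BX = (T ∘₍ₙ₎ B) ∘ X - T ∘₍ₙ₎ (B ∘ X)`. -/
def circNAux : ℕ → {f : SymmetricAlgebra R L →ₗ[R] L →ₗ[R] L // Admissible R L f}
  | 0 =>
    have h := exists_rec (R := R) (L := L) (LinearMap.id : L →ₗ[R] L) 0 (by simp)
    ⟨h.choose, admissible_of_step (f := 0) fun x B => by
      rw [h.choose_spec.2]; ext T; simp [circStep_apply]⟩
  | n + 1 =>
    have h := exists_rec (R := R) (L := L) (0 : L →ₗ[R] L) (circStep R L (circNAux n).1)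
      (circNAux n).2
    ⟨h.choose, admissible_of_step h.choose_spec.2⟩

/-- The maps of `circNAux`. -/
def circN (n : ℕ) : SymmetricAlgebra R L →ₗ[R] L →ₗ[R] L := (circNAux R L n).1

theorem circN_zero_one : circN R L 0 1 = LinearMap.id :=
  (exists_rec (R := R) (L := L) (LinearMap.id : L →ₗ[R] L) 0 (by simp)).choose_spec.1

theorem circN_zero_mul (x : L) (B : SymmetricAlgebra R L) :
    circN R L 0 (SymmetricAlgebra.ι R L x * B) = 0 :=
  (exists_rec (R := R) (L := L) (LinearMap.id : L →ₗ[R] L) 0 (by simp)).choose_spec.2 x B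

theorem circN_succ_one (n : ℕ) : circN R L (n + 1) 1 = 0 :=
  (exists_rec (R := R) (L := L) (0 : L →ₗ[R] L) (circStep R L (circNAux R L n).1)
      (circNAux R L n).2).choose_spec.1

theorem circN_succ_mul (n : ℕ) (x : L) (B : SymmetricAlgebra R L) (T : L) :
    circN R L (n + 1) (SymmetricAlgebra.ι R L x * B) T =
      circN R L n B T * x - circN R L n (rightAct R L x B) T :=
  congr($((exists_rec (R := R) (L := L) (0 : L →ₗ[R] L) (circStep R L (circNAux R L n).1)
      (circNAux R L n).2).choose_spec.2 x B) T)

/-- Elements of length at most `k`. -/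
def lengthLE : ℕ → Submodule R (SymmetricAlgebra R L)
  | 0 => Submodule.span R {1}
  | k + 1 => lengthLE k ⊔
      Submodule.span R {A | ∃ (x : L), ∃ B ∈ lengthLE k, A = SymmetricAlgebra.ι R L x * B}

theorem rightAct_mem_lengthLE (x : L) (k : ℕ) :
    ∀ A ∈ lengthLE R L k, rightAct R L x A ∈ lengthLE R L k := by
  induction k with
  | zero =>
    intro A hA
    obtain ⟨r, rfl⟩ := Submodule.mem_span_singleton.1 hA
    simp
  | succ k ih =>
    change lengthLE R L (k + 1) ≤ (lengthLE R L (k + 1)).comap (rightAct R L x).toLinearMap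
    refine sup_le (fun A hA => Submodule.mem_sup_left (ih A hA)) (Submodule.span_le.2 ?_)
    rintro _ ⟨y, B, hB, rfl⟩
    refine Submodule.mem_sup_right ?_
    change rightAct R L x _ ∈ _
    rw [Derivation.leibniz, rightAct_ι, smul_eq_mul, smul_eq_mul, mul_comm B]
    exact Submodule.add_mem _ (Submodule.subset_span ⟨y, _, ih B hB, rfl⟩)
      (Submodule.subset_span ⟨_, B, hB, rfl⟩)

theorem circN_eq_zero (k : ℕ) : ∀ A ∈ lengthLE R L k, ∀ n, k < n → circN R L n A = 0 := by
  induction k with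
  | zero =>
    intro A hA n hn
    obtain ⟨r, rfl⟩ := Submodule.mem_span_singleton.1 hA
    obtain ⟨n, rfl⟩ := Nat.exists_eq_succ_of_ne_zero hn.ne'
    rw [map_smul, circN_succ_one, smul_zero]
  | succ k ih =>
    intro A hA n hn
    revert A
    change lengthLE R L (k + 1) ≤ LinearMap.ker (circN R L n)
    refine sup_le (fun A hA => ih A hA n (by lia)) (Submodule.span_le.2 ?_)
    rintro _ ⟨x, B, hB, rfl⟩
    obtain ⟨n, rfl⟩ := Nat.exists_eq_succ_of_ne_zero (show n ≠ 0 by lia)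
    change circN R L (n + 1) _ = 0
    ext T
    rw [circN_succ_mul, ih B hB n (by lia), ih _ (rightAct_mem_lengthLE R L x k B hB) n (by lia)]
    simp

theorem exists_mem_lengthLE (A : SymmetricAlgebra R L) : ∃ k, A ∈ lengthLE R L k := by
  have hm : Monotone (lengthLE R L) := monotone_nat_of_le_succ fun k => le_sup_left
  have h := submodule_eq_top (⨆ k, lengthLE R L k)
    (Submodule.mem_iSup_of_mem 0 (Submodule.mem_span_singleton_self 1))
    (fun x B hB => by
      obtain ⟨k, hk⟩ := (Submodule.mem_iSup_of_directed _ hm.directed_le).1 hB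
      exact Submodule.mem_iSup_of_mem (k + 1)
        (Submodule.mem_sup_right (Submodule.subset_span ⟨x, B, hk, rfl⟩))) A
  exact (Submodule.mem_iSup_of_directed _ hm.directed_le).1 h

theorem circN_finite (A : SymmetricAlgebra R L) :
    (Function.support fun n => circN R L n A).Finite := by
  obtain ⟨k, hk⟩ := exists_mem_lengthLE R L A
  refine (Set.finite_le_nat k).subset fun n hn => ?_
  by_contra hlt
  exact hn (circN_eq_zero R L k A hk n (not_le.1 hlt))

/-- `T ∘ A ∈ L` for `T ∈ L` and `A ∈ S(L)`, as `circL A T`: the sum over `n` of `T ∘₍ₙ₎ A`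
(finitely many terms are nonzero). -/
def circL : SymmetricAlgebra R L →ₗ[R] L →ₗ[R] L where
  toFun A := ∑ᶠ n, circN R L n A
  map_add' A B := by
    simp only [map_add]
    exact finsum_add_distrib (circN_finite R L A) (circN_finite R L B)
  map_smul' r A := by
    simp only [map_smul, RingHom.id_apply]
    exact (smul_finsum' r (circN_finite R L A)).symm

theorem circL_eq_sum (A : SymmetricAlgebra R L) (k : ℕ) (hA : A ∈ lengthLE R L k) :
    circL R L A = ∑ n ∈ Finset.range (k + 1), circN R L n A := by
  refine finsum_eq_sum_of_support_subset _ fun n hn => ?_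
  by_contra hlt
  simp only [Finset.coe_range, Set.mem_Iio, not_lt] at hlt
  exact hn (circN_eq_zero R L k A hA n (by lia))

/-- `T ∘ 1 = T`. -/
theorem circL_one : circL R L 1 = LinearMap.id := by
  rw [circL_eq_sum R L 1 0 (Submodule.mem_span_singleton_self 1)]
  simp [circN_zero_one]

/-- `T ∘ BX = (T ∘ B) ∘ X - T ∘ (B ∘ X)`. -/
theorem circL_mul (x : L) (B : SymmetricAlgebra R L) (T : L) :
    circL R L (SymmetricAlgebra.ι R L x * B) T =
      circL R L B T * x - circL R L (rightAct R L x B) T := by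
  obtain ⟨k, hk⟩ := exists_mem_lengthLE R L B
  rw [circL_eq_sum R L B k hk, circL_eq_sum R L _ k (rightAct_mem_lengthLE R L x k B hk),
    circL_eq_sum R L _ (k + 1)
      (Submodule.mem_sup_right (Submodule.subset_span ⟨x, B, hk, rfl⟩)),
    Finset.sum_range_succ', circN_zero_mul]
  simp [LinearMap.sum_apply, circN_succ_mul, Finset.sum_mul]

/-- The product `∘` as a morphism from `S(L)` to the linear endomorphisms of `S(L)` with the
convolution product: multiplicativity means `AB ∘ C = (A ∘ C₍₁₎)(B ∘ C₍₂₎)`. -/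
def circAlgHom : SymmetricAlgebra R L →ₐ[R]
    WithConv (SymmetricAlgebra R L →ₗ[R] SymmetricAlgebra R L) :=
  SymmetricAlgebra.lift
    { toFun := fun T => WithConv.toConv (SymmetricAlgebra.ι R L ∘ₗ (circL R L).flip T)
      map_add' := fun T T' => by ext A; simp
      map_smul' := fun r T => by ext A; simp }

/-- The product `A ∘ B` on `S(L)`. -/
def circ : SymmetricAlgebra R L →ₗ[R] SymmetricAlgebra R L →ₗ[R] SymmetricAlgebra R L where
  toFun A := (circAlgHom R L A).ofConv
  map_add' A B := by simp
  map_smul' r A := by simp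

/-- On `L ⊗ S(L)` the product `∘` is the recursively defined one. -/
theorem circ_ι (T : L) (B : SymmetricAlgebra R L) :
    circ R L (SymmetricAlgebra.ι R L T) B = SymmetricAlgebra.ι R L (circL R L B T) := by
  simp [circ, circAlgHom]

/-- `AB ∘ C = (A ∘ C₍₁₎)(B ∘ C₍₂₎)`. -/
theorem circ_mul (A B C : SymmetricAlgebra R L) :
    circ R L (A * B) C = LinearMap.mul' R (SymmetricAlgebra R L)
      (TensorProduct.map (circ R L A) (circ R L B) (Coalgebra.comul C)) := by
  simp [circ]

/-- `A ∘ 1 = A`. -/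
theorem circ_one (A : SymmetricAlgebra R L) : circ R L A 1 = A := by
  induction A using SymmetricAlgebra.induction with
  | algebraMap r =>
    simp [circ, Algebra.algebraMap_eq_smul_one]
  | ι x => rw [circ_ι, circL_one]; rfl
  | mul a b ha hb => rw [circ_mul, Bialgebra.comul_one, Algebra.TensorProduct.one_def]; simp [ha, hb]
  | add a b ha hb => simp [ha, hb]

/-- `A ∘ X` for a letter `X` is the right action of `L` on `S(L)`. -/
theorem circ_apply_ι (A : SymmetricAlgebra R L) (x : L) :
    circ R L A (SymmetricAlgebra.ι R L x) = rightAct R L x A := by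
  induction A using SymmetricAlgebra.induction with
  | algebraMap r => simp [circ]
  | ι T =>
    have := circL_mul R L x 1 T
    rw [mul_one] at this
    rw [circ_ι, this, circL_one]; simp
  | mul a b ha hb =>
    rw [circ_mul, SymmetricAlgebra.comul_ι]
    simp [circ_one, ha, hb, mul_comm]
    abel
  | add a b ha hb => simp [ha, hb]

/-- The product `A * B = (A ∘ B₍₁₎) B₍₂₎` on `S(L)`. -/
def starProd : SymmetricAlgebra R L →ₗ[R] SymmetricAlgebra R L →ₗ[R] SymmetricAlgebra R L where
  toFun A := LinearMap.mul' R (SymmetricAlgebra R L) ∘ₗ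
    (circ R L A).rTensor (SymmetricAlgebra R L) ∘ₗ Coalgebra.comul
  map_add' A B := by simp [LinearMap.rTensor_add, LinearMap.add_comp, LinearMap.comp_add]
  map_smul' r A := by simp [LinearMap.rTensor_smul, LinearMap.smul_comp, LinearMap.comp_smul]

end Circ

/-! ### Hopf algebras -/

/-- `(A, mul, one)` together with the coproduct and counit of the coalgebra `A` is a Hopf algebra
with the given antipode. This is `HopfAlgebra`, for a product that is not a registered instance. -/
structure IsHopfAlgebra {R A : Type*} [CommRing R] [AddCommGroup A] [Module R A] [Coalgebra R A]
    (mul : A →ₗ[R] A →ₗ[R] A) (one : A) (antipode : A →ₗ[R] A) : Prop where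
  mul_assoc : ∀ a b c, mul (mul a b) c = mul a (mul b c)
  one_mul : ∀ a, mul one a = a
  mul_one : ∀ a, mul a one = a
  counit_one : Coalgebra.counit (R := R) one = 1
  counit_mul : ∀ a b, Coalgebra.counit (R := R) (mul a b) =
    Coalgebra.counit (R := R) a * Coalgebra.counit (R := R) b
  comul_one : Coalgebra.comul (R := R) one = one ⊗ₜ[R] one
  comul_mul : ∀ a b, Coalgebra.comul (R := R) (mul a b) =
    TensorProduct.map₂ mul mul (Coalgebra.comul a) (Coalgebra.comul b)
  antipode_left : ∀ a, TensorProduct.lift mul (antipode.rTensor A (Coalgebra.comul a)) =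
    Coalgebra.counit (R := R) a • one
  antipode_right : ∀ a, TensorProduct.lift mul (antipode.lTensor A (Coalgebra.comul a)) =
    Coalgebra.counit (R := R) a • one

section Enveloping

variable (R L : Type*) [CommRing R] [LieRing L] [LieAlgebra R L]

attribute [local instance 100] LieRing.ofAssociativeRing

/-- The morphism of Lie algebras `x ↦ x ⊗ 1 + 1 ⊗ x`. -/
def envComulLie : L →ₗ⁅R⁆ UniversalEnvelopingAlgebra R L ⊗[R] UniversalEnvelopingAlgebra R L where
  toFun x := UniversalEnvelopingAlgebra.ι R x ⊗ₜ[R] 1 + 1 ⊗ₜ[R] UniversalEnvelopingAlgebra.ι R x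
  map_add' x y := by simp only [map_add, TensorProduct.add_tmul, TensorProduct.tmul_add]; abel
  map_smul' r x := by
    simp only [map_smul, TensorProduct.smul_tmul', TensorProduct.tmul_smul, smul_add,
      RingHom.id_apply]
  map_lie' {x y} := by
    simp only [LieHom.map_lie, LieRing.of_associative_ring_bracket, TensorProduct.sub_tmul,
      TensorProduct.tmul_sub, mul_add, add_mul, Algebra.TensorProduct.tmul_mul_tmul, one_mul,
      mul_one]
    abel

/-- The morphism of Lie algebras `x ↦ -x` to the opposite of the enveloping algebra. -/
def envAntipodeLie : L →ₗ⁅R⁆ (UniversalEnvelopingAlgebra R L)ᵐᵒᵖ where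
  toFun x := MulOpposite.op (-UniversalEnvelopingAlgebra.ι R x)
  map_add' x y := by rw [map_add, neg_add, MulOpposite.op_add]
  map_smul' r x := by rw [map_smul, ← smul_neg, MulOpposite.op_smul, RingHom.id_apply]
  map_lie' {x y} := by
    simp only [LieHom.map_lie, LieRing.of_associative_ring_bracket, ← MulOpposite.op_mul,
      ← MulOpposite.op_sub, neg_mul_neg, neg_sub]

theorem env_algHom_ext {A : Type*} [Ring A] [Algebra R A]
    {F G : UniversalEnvelopingAlgebra R L →ₐ[R] A}
    (h : ∀ x, F (UniversalEnvelopingAlgebra.ι R x) = G (UniversalEnvelopingAlgebra.ι R x)) :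
    F = G :=
  UniversalEnvelopingAlgebra.hom_ext R (LieHom.ext h)

/-- The usual bialgebra structure of the enveloping algebra: the elements of `L` are primitive. -/
instance envBialgebra : Bialgebra R (UniversalEnvelopingAlgebra R L) :=
  .ofAlgHom (UniversalEnvelopingAlgebra.lift R (envComulLie R L))
    (UniversalEnvelopingAlgebra.lift R (0 : L →ₗ⁅R⁆ R))
    (env_algHom_ext R L fun x => by
      simp only [AlgHom.comp_apply, UniversalEnvelopingAlgebra.lift_ι_apply]
      simp [envComulLie, -UniversalEnvelopingAlgebra.ι_apply, TensorProduct.add_tmul, TensorProduct.tmul_add,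
        UniversalEnvelopingAlgebra.lift_ι_apply, Algebra.TensorProduct.one_def]
      abel)
    (env_algHom_ext R L fun x => by
      simp [envComulLie, -UniversalEnvelopingAlgebra.ι_apply,
        UniversalEnvelopingAlgebra.lift_ι_apply])
    (env_algHom_ext R L fun x => by
      simp [envComulLie, -UniversalEnvelopingAlgebra.ι_apply,
        UniversalEnvelopingAlgebra.lift_ι_apply])

theorem env_comul_ι (x : L) : Coalgebra.comul (R := R) (UniversalEnvelopingAlgebra.ι R x) =
    UniversalEnvelopingAlgebra.ι R x ⊗ₜ[R] 1 + 1 ⊗ₜ[R] UniversalEnvelopingAlgebra.ι R x :=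
  UniversalEnvelopingAlgebra.lift_ι_apply R (envComulLie R L) x

theorem env_counit_ι (x : L) :
    Coalgebra.counit (R := R) (UniversalEnvelopingAlgebra.ι R x) = 0 :=
  UniversalEnvelopingAlgebra.lift_ι_apply R (0 : L →ₗ⁅R⁆ R) x

/-- The antipode of the enveloping algebra: the anti-automorphism with `x ↦ -x` on `L`. -/
def envAntipode : UniversalEnvelopingAlgebra R L →ₗ[R] UniversalEnvelopingAlgebra R L :=
  (MulOpposite.opLinearEquiv R).symm.toLinearMap ∘ₗ
    (UniversalEnvelopingAlgebra.lift R (envAntipodeLie R L)).toLinearMap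

theorem envAntipode_ι (x : L) : envAntipode R L (UniversalEnvelopingAlgebra.ι R x) =
    -UniversalEnvelopingAlgebra.ι R x :=
  congr(MulOpposite.unop $(UniversalEnvelopingAlgebra.lift_ι_apply R (envAntipodeLie R L) x))

theorem envAntipode_mul (a b : UniversalEnvelopingAlgebra R L) :
    envAntipode R L (a * b) = envAntipode R L b * envAntipode R L a := by
  simp [envAntipode]

theorem envAntipode_algebraMap (r : R) :
    envAntipode R L (algebraMap R _ r) = algebraMap R _ r := by
  simp [envAntipode]

theorem env_induction {p : UniversalEnvelopingAlgebra R L → Prop}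
    (h0 : ∀ r, p (algebraMap R _ r)) (hι : ∀ x, p (UniversalEnvelopingAlgebra.ι R x))
    (hm : ∀ a b, p a → p b → p (a * b)) (ha : ∀ a b, p a → p b → p (a + b))
    (a : UniversalEnvelopingAlgebra R L) : p a := by
  let V : Subalgebra R (UniversalEnvelopingAlgebra R L) :=
    { carrier := {a | p a}
      mul_mem' := fun {a b} h h' => hm a b h h'
      add_mem' := fun {a b} h h' => ha a b h h'
      algebraMap_mem' := h0 }
  let f : L →ₗ⁅R⁆ V :=
    { toFun := fun x => ⟨UniversalEnvelopingAlgebra.ι R x, hι x⟩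
      map_add' := fun x y => Subtype.ext (map_add _ _ _)
      map_smul' := fun r x => Subtype.ext (map_smul _ _ _)
      map_lie' := fun {x y} => Subtype.ext (LieHom.map_lie _ _ _) }
  have h : V.val.comp (UniversalEnvelopingAlgebra.lift R f) = AlgHom.id R _ :=
    env_algHom_ext R L fun x => by
      rw [AlgHom.comp_apply, UniversalEnvelopingAlgebra.lift_ι_apply]; rfl
  have h' : (UniversalEnvelopingAlgebra.lift R f a : UniversalEnvelopingAlgebra R L) = a :=
    congr($h a)
  rw [← h']
  exact (UniversalEnvelopingAlgebra.lift R f a).2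

theorem env_antipode_left (a : UniversalEnvelopingAlgebra R L) :
    LinearMap.mul' R _ ((envAntipode R L).rTensor _ (Coalgebra.comul a)) =
      algebraMap R _ (Coalgebra.counit (R := R) a) := by
  induction a using env_induction with
  | h0 r => simp [Algebra.TensorProduct.algebraMap_apply, envAntipode_algebraMap]
  | hι x =>
    have h1 := envAntipode_algebraMap R L 1
    rw [map_one] at h1
    rw [env_comul_ι, env_counit_ι]
    simp [-UniversalEnvelopingAlgebra.ι_apply, envAntipode_ι, h1]
  | hm a b ha hb =>
    have key : ∀ s t : UniversalEnvelopingAlgebra R L ⊗[R] UniversalEnvelopingAlgebra R L,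
        ∀ r : R, LinearMap.mul' R _ ((envAntipode R L).rTensor _ s) = algebraMap R _ r →
        LinearMap.mul' R _ ((envAntipode R L).rTensor _ (s * t)) =
          r • LinearMap.mul' R _ ((envAntipode R L).rTensor _ t) := by
      intro s t r hs
      induction t with
      | zero => simp
      | add t t' h h' => rw [mul_add, map_add, map_add, h, h', map_add, map_add, smul_add]
      | tmul u v =>
        have : LinearMap.mul' R _ ((envAntipode R L).rTensor _ (s * u ⊗ₜ v)) =
            envAntipode R L u * LinearMap.mul' R _ ((envAntipode R L).rTensor _ s) * v := by
          clear hs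
          induction s with
          | zero => simp
          | add s s' h h' => simp only [add_mul, mul_add, map_add, h, h']
          | tmul p q => simp [envAntipode_mul, mul_assoc]
        rw [this, hs, ← Algebra.commutes, mul_assoc, ← Algebra.smul_def]
        simp
    rw [Bialgebra.comul_mul, key _ _ _ ha, hb, Bialgebra.counit_mul, map_mul, Algebra.smul_def]
  | ha a b ha hb => simp only [map_add, ha, hb]

theorem env_antipode_right (a : UniversalEnvelopingAlgebra R L) :
    LinearMap.mul' R _ ((envAntipode R L).lTensor _ (Coalgebra.comul a)) =
      algebraMap R _ (Coalgebra.counit (R := R) a) := by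
  have h1 := envAntipode_algebraMap R L 1
  rw [map_one] at h1
  induction a using env_induction with
  | h0 r => simp [Algebra.TensorProduct.algebraMap_apply, h1]
  | hι x =>
    rw [env_comul_ι, env_counit_ι]
    simp [-UniversalEnvelopingAlgebra.ι_apply, envAntipode_ι, h1]
  | hm a b ha hb =>
    have key : ∀ s t : UniversalEnvelopingAlgebra R L ⊗[R] UniversalEnvelopingAlgebra R L,
        ∀ r : R, LinearMap.mul' R _ ((envAntipode R L).lTensor _ t) = algebraMap R _ r →
        LinearMap.mul' R _ ((envAntipode R L).lTensor _ (s * t)) =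
          r • LinearMap.mul' R _ ((envAntipode R L).lTensor _ s) := by
      intro s t r ht
      induction s with
      | zero => simp
      | add s s' h h' => rw [add_mul, map_add, map_add, h, h', map_add, map_add, smul_add]
      | tmul u v =>
        have : LinearMap.mul' R _ ((envAntipode R L).lTensor _ (u ⊗ₜ v * t)) =
            u * LinearMap.mul' R _ ((envAntipode R L).lTensor _ t) * envAntipode R L v := by
          clear ht
          induction t with
          | zero => simp
          | add s s' h h' => simp only [add_mul, mul_add, map_add, h, h']
          | tmul p q => simp [envAntipode_mul, mul_assoc]
        rw [this, ht, ← Algebra.commutes, mul_assoc, ← Algebra.smul_def]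
        simp
    rw [Bialgebra.comul_mul, key _ _ _ hb, ha, Bialgebra.counit_mul, map_mul, Algebra.smul_def,
      Algebra.commutes]
  | ha a b ha hb => simp only [map_add, ha, hb]

/-- The usual Hopf algebra structure of the enveloping algebra of a Lie algebra. -/
instance envHopfAlgebra : HopfAlgebra R (UniversalEnvelopingAlgebra R L) where
  antipode := envAntipode R L
  mul_antipode_rTensor_comul := LinearMap.ext (env_antipode_left R L)
  mul_antipode_lTensor_comul := LinearMap.ext (env_antipode_right R L)

end Enveloping

end PreLieSym

end

noncomputable section

namespace PreLieSym

section Circ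

variable (R L : Type*) [CommRing R] [RightPreLieRing L] [RightPreLieAlgebra R L]

attribute [local instance 100] LieRing.ofAssociativeRing

/-! ### Right multiplication by a letter -/

/-! The product `*` on `S(L)` is never shown to be associative directly: it is identified with the
product of the enveloping algebra `U`, and the Hopf structure is transported. For a letter `X` put
`ρ_X A = XA + A ∘ X`. Right symmetry makes `ρ` a right representation of the Lie algebra `L`, so
`S(L)` becomes a right `U`-module; let `η u = 1 · u`.

Multiplicativity of `η` rests on `starProd_starRight`: `A * -` commutes with every `ρ_X`, hence with
the action of `U`. Together with `A * 1 = A` this gives `A * η u = A · u`, so `η (uv) = η u · v = η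
u * η v`. The underlying facts are that `ρ_X` is a coderivation (`comul_starRight`) and that `A ∘
ρ_X B = (A ∘ B) ∘ X` (`circ_starRight`). The coderivation property also makes `η` a morphism of
coalgebras.

Bijectivity needs no Poincaré–Birkhoff–Witt theorem, so any base ring is allowed. Since `XB = ρ_X B
- B ∘ X` and `∘ X` does not raise length, `η` is onto by induction on length. The same identity
forces the recursion `f (XB) = f B · X - f (B ∘ X)` for an inverse; right symmetry makes it
independent of the order of the letters, and its solution is a left inverse of `η`. -/

/-- Right multiplication by a letter for the product `*`: `A * X = AX + A ∘ X`. -/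
def starRight : L →ₗ[R] Module.End R (SymmetricAlgebra R L) where
  toFun x := LinearMap.mulLeft R (SymmetricAlgebra.ι R L x) + (rightAct R L x).toLinearMap
  map_add' x y := by ext A; simp [add_mul]; abel
  map_smul' r x := by ext A; simp

theorem starRight_apply (x : L) (A : SymmetricAlgebra R L) :
    starRight R L x A = SymmetricAlgebra.ι R L x * A + rightAct R L x A := rfl

theorem starRight_one (x : L) : starRight R L x 1 = SymmetricAlgebra.ι R L x := by
  simp [starRight_apply]

/-- The right multiplications by letters form a right representation of the Lie algebra `L`. -/
theorem starRight_lie (x y : L) (A : SymmetricAlgebra R L) :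
    starRight R L ⁅x, y⁆ A =
      starRight R L y (starRight R L x A) - starRight R L x (starRight R L y A) := by
  have h := rightAct_symm R L x y A
  have hb : ⁅x, y⁆ = x * y - y * x := rfl
  simp only [starRight_apply, hb, map_add, map_sub, Derivation.leibniz, rightAct_ι, smul_eq_mul,
    LinearMap.sub_apply]
  -- The terms `XYA`, `X (A ∘ Y)` and `Y (A ∘ X)` cancel in the commutator. What remains is `[X, Y]
  -- A` and the right symmetry of the action on `A`.
  linear_combination -h

/-! ### The module structure over the enveloping algebra and the orbit map of `1` -/

/-- The right action of the enveloping algebra on `S(L)`. -/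
def envAct : UniversalEnvelopingAlgebra R L →ₐ[R] (Module.End R (SymmetricAlgebra R L))ᵐᵒᵖ :=
  UniversalEnvelopingAlgebra.lift R
    { toFun := fun x => MulOpposite.op (starRight R L x)
      map_add' := fun x y => by rw [map_add, MulOpposite.op_add]
      map_smul' := fun r x => by rw [map_smul, MulOpposite.op_smul, RingHom.id_apply]
      map_lie' := fun {x y} => by
        rw [LieRing.of_associative_ring_bracket, ← MulOpposite.op_mul, ← MulOpposite.op_mul,
          ← MulOpposite.op_sub]
        exact congrArg MulOpposite.op (LinearMap.ext (starRight_lie R L x y)) }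

theorem envAct_ι (x : L) (A : SymmetricAlgebra R L) :
    (envAct R L (UniversalEnvelopingAlgebra.ι R x)).unop A = starRight R L x A :=
  LinearMap.congr_fun
    (congrArg MulOpposite.unop (UniversalEnvelopingAlgebra.lift_ι_apply R _ x)) A

theorem envAct_mul (u v : UniversalEnvelopingAlgebra R L) (A : SymmetricAlgebra R L) :
    (envAct R L (u * v)).unop A = (envAct R L v).unop ((envAct R L u).unop A) := by
  simp

/-- The map `u ↦ 1 · u` from the enveloping algebra to `S(L)`. -/
def envToSym : UniversalEnvelopingAlgebra R L →ₗ[R] SymmetricAlgebra R L :=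
  LinearMap.applyₗ 1 ∘ₗ (MulOpposite.opLinearEquiv R).symm.toLinearMap ∘ₗ
    (envAct R L).toLinearMap

theorem envToSym_apply (u : UniversalEnvelopingAlgebra R L) :
    envToSym R L u = (envAct R L u).unop 1 := rfl

theorem envToSym_one : envToSym R L 1 = 1 := by
  simp [envToSym_apply]

theorem envToSym_ι (x : L) :
    envToSym R L (UniversalEnvelopingAlgebra.ι R x) = SymmetricAlgebra.ι R L x := by
  rw [envToSym_apply, envAct_ι, starRight_one]

theorem envToSym_mul (u v : UniversalEnvelopingAlgebra R L) :
    envToSym R L (u * v) = (envAct R L v).unop (envToSym R L u) :=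
  envAct_mul R L u v 1

theorem envToSym_mul_ι (u : UniversalEnvelopingAlgebra R L) (x : L) :
    envToSym R L (u * UniversalEnvelopingAlgebra.ι R x) = starRight R L x (envToSym R L u) := by
  rw [envToSym_mul, envAct_ι]

/-- A submodule of the enveloping algebra that contains `1` and is stable under right
multiplication by elements of `L` is everything. -/
theorem env_submodule_eq_top (V : Submodule R (UniversalEnvelopingAlgebra R L)) (h1 : 1 ∈ V)
    (hx : ∀ (u : UniversalEnvelopingAlgebra R L) (x : L), u ∈ V →
      u * UniversalEnvelopingAlgebra.ι R x ∈ V)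
    (u : UniversalEnvelopingAlgebra R L) : u ∈ V := by
  have key : ∀ u : UniversalEnvelopingAlgebra R L, ∀ v ∈ V, v * u ∈ V := by
    intro u
    induction u using env_induction with
    | h0 r => intro v hv; rw [← Algebra.commutes, ← Algebra.smul_def]; exact V.smul_mem r hv
    | hι x => exact fun v hv => hx v x hv
    | hm a b ha hb => intro v hv; rw [← mul_assoc]; exact hb _ (ha _ hv)
    | ha a b ha hb => intro v hv; rw [mul_add]; exact V.add_mem (ha _ hv) (hb _ hv)
  simpa using key u 1 h1

/-! ### Compatibility with the coproduct -/

/-- A derivation that sends letters to letters is a coderivation: `key` is the Leibniz rule for `D ⊗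
1 + 1 ⊗ D` on `S(L) ⊗ S(L)`, so it is enough to check generators, which are primitive. -/
theorem comul_rightAct (x : L) (A : SymmetricAlgebra R L) :
    Coalgebra.comul (R := R) (rightAct R L x A) =
      (rightAct R L x).toLinearMap.rTensor _ (Coalgebra.comul A) +
        (rightAct R L x).toLinearMap.lTensor _ (Coalgebra.comul A) := by
  have key : ∀ s t : SymmetricAlgebra R L ⊗[R] SymmetricAlgebra R L,
      (rightAct R L x).toLinearMap.rTensor _ (s * t) +
        (rightAct R L x).toLinearMap.lTensor _ (s * t) =
      s * ((rightAct R L x).toLinearMap.rTensor _ t + (rightAct R L x).toLinearMap.lTensor _ t) +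
      t * ((rightAct R L x).toLinearMap.rTensor _ s +
        (rightAct R L x).toLinearMap.lTensor _ s) := by
    intro s t
    induction s with
    | zero => simp
    | add s s' h h' => simp only [add_mul, mul_add, map_add] at h h' ⊢; linear_combination h + h'
    | tmul a b =>
      induction t with
      | zero => simp
      | add s s' h h' => simp only [add_mul, mul_add, map_add] at h h' ⊢; linear_combination h + h'
      | tmul c d =>
        simp only [Algebra.TensorProduct.tmul_mul_tmul, LinearMap.rTensor_tmul,
          LinearMap.lTensor_tmul, Derivation.coeFn_coe, Derivation.leibniz, smul_eq_mul,
          TensorProduct.add_tmul, TensorProduct.tmul_add, mul_add, mul_comm c, mul_comm d]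
        abel
  induction A using SymmetricAlgebra.induction with
  | algebraMap r => simp [Algebra.algebraMap_eq_smul_one, Algebra.TensorProduct.one_def]
  | ι y => simp
  | mul a b ha hb =>
    rw [Derivation.leibniz, Bialgebra.comul_mul, key, map_add, smul_eq_mul, smul_eq_mul,
      Bialgebra.comul_mul, Bialgebra.comul_mul, ha, hb]
  | add a b ha hb => simp only [map_add, ha, hb]; abel

theorem counit_rightAct (x : L) (A : SymmetricAlgebra R L) :
    Coalgebra.counit (R := R) (rightAct R L x A) = 0 := by
  induction A using SymmetricAlgebra.induction with
  | algebraMap r => simp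
  | ι y => simp
  | mul a b ha hb => simp [ha, hb]
  | add a b ha hb => simp only [map_add, ha, hb, add_zero]

/-- Multiplication by a primitive element is a coderivation (this is `key`), and so is `∘ X`; `ρ_X`
is their sum. -/
theorem comul_starRight (x : L) (A : SymmetricAlgebra R L) :
    Coalgebra.comul (R := R) (starRight R L x A) =
      (starRight R L x).rTensor _ (Coalgebra.comul A) +
        (starRight R L x).lTensor _ (Coalgebra.comul A) := by
  have h : starRight R L x =
    LinearMap.mulLeft R (SymmetricAlgebra.ι R L x) + (rightAct R L x).toLinearMap := rfl
  have key : ∀ s : SymmetricAlgebra R L ⊗[R] SymmetricAlgebra R L,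
      Coalgebra.comul (R := R) (SymmetricAlgebra.ι R L x) * s =
        (LinearMap.mulLeft R (SymmetricAlgebra.ι R L x)).rTensor _ s +
          (LinearMap.mulLeft R (SymmetricAlgebra.ι R L x)).lTensor _ s := by
    intro s
    induction s with
    | zero => simp
    | add s s' h h' => simp only [mul_add, map_add, h, h']; abel
    | tmul a b => simp [add_mul]
  rw [starRight_apply, map_add, Bialgebra.comul_mul, comul_rightAct, key, h, LinearMap.rTensor_add,
    LinearMap.lTensor_add, LinearMap.add_apply, LinearMap.add_apply]
  abel

theorem counit_starRight (x : L) (A : SymmetricAlgebra R L) :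
    Coalgebra.counit (R := R) (starRight R L x A) = 0 := by
  rw [starRight_apply, map_add, Bialgebra.counit_mul, counit_rightAct, SymmetricAlgebra.counit_ι,
    zero_mul, add_zero]

/-- `A ∘ (B * X) = (A ∘ B) ∘ X`. -/
theorem circ_starRight (A : SymmetricAlgebra R L) :
    ∀ (x : L) (B : SymmetricAlgebra R L),
      circ R L A (starRight R L x B) = rightAct R L x (circ R L A B) := by
  induction A using SymmetricAlgebra.induction with
  | algebraMap r =>
    intro x B
    -- The unit of the convolution product is the counit, so a constant satisfies `r ∘ C = r ε(C)`;
    -- both sides of the claim then vanish.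
    have h : ∀ C, circ R L (algebraMap R _ r) C =
        algebraMap R _ (r * Coalgebra.counit (R := R) C) := by
      intro C
      simp [circ, Algebra.smul_def]
    rw [h, h, counit_starRight, mul_zero, map_zero, Derivation.map_algebraMap]
  | ι T =>
    intro x B
    -- This is the defining recursion of `T ∘ BX` with `T ∘ (B ∘ X)` moved to the other side.
    rw [circ_ι, circ_ι, rightAct_ι, starRight_apply, map_add, LinearMap.add_apply, circL_mul,
      sub_add_cancel]
  | mul a b ha hb =>
    intro x B
    -- `ρ_X` splits over the two tensor factors as a coderivation, matching the Leibniz rule for `∘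
    -- X` on the product.
    rw [circ_mul, circ_mul, comul_starRight]
    generalize Coalgebra.comul (R := R) B = s
    induction s with
    | zero => simp
    | add s s' h h' => simp only [map_add] at h h' ⊢; rw [← h, ← h']; abel
    | tmul c d => simp [ha, hb, mul_comm]; abel
  | add a b ha hb => intro x B; simp only [map_add, LinearMap.add_apply, ha, hb]

/-! ### The product `*` in terms of the action -/

theorem starProd_apply (A B : SymmetricAlgebra R L) :
    starProd R L A B = LinearMap.mul' R (SymmetricAlgebra R L)
      ((circ R L A).rTensor (SymmetricAlgebra R L) (Coalgebra.comul B)) := rfl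

theorem starProd_one (A : SymmetricAlgebra R L) : starProd R L A 1 = A := by
  rw [starProd_apply, Bialgebra.comul_one, Algebra.TensorProduct.one_def]
  simp [circ_one]

/-- `A * (B * X) = (A * B) * X`. -/
theorem starProd_starRight (A B : SymmetricAlgebra R L) (x : L) :
    starProd R L A (starRight R L x B) = starRight R L x (starProd R L A B) := by
  rw [starProd_apply, starProd_apply, comul_starRight]
  generalize Coalgebra.comul (R := R) B = s
  induction s with
  | zero => simp
  | add s s' h h' => simp only [map_add] at h h' ⊢; rw [← h, ← h']; abel
  | tmul c d =>
    simp only [map_add, LinearMap.rTensor_tmul, LinearMap.lTensor_tmul, LinearMap.mul'_apply,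
      circ_starRight]
    -- With `E = A ∘ c` the identity reads `(E ∘ X) d + E (Xd + d ∘ X) = X E d + (E d) ∘ X`.
    simp only [starRight_apply, Derivation.leibniz, smul_eq_mul]
    ring

theorem starProd_envAct (u : UniversalEnvelopingAlgebra R L) :
    ∀ A B, starProd R L A ((envAct R L u).unop B) = (envAct R L u).unop (starProd R L A B) := by
  induction u using env_induction with
  | h0 r => simp
  | hι x => intro A B; rw [envAct_ι, envAct_ι, starProd_starRight]
  | hm a b ha hb => intro A B; rw [envAct_mul, envAct_mul, hb, ha]
  | ha a b ha hb => intro A B; simp [ha, hb]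

/-- Evaluating the commutation of `A * -` with the action at `1` shows that right `*`-multiplication
by the image of `u` is the action of `u`. -/
theorem starProd_envToSym (A : SymmetricAlgebra R L) (u : UniversalEnvelopingAlgebra R L) :
    starProd R L A (envToSym R L u) = (envAct R L u).unop A := by
  rw [envToSym_apply, starProd_envAct, starProd_one]

theorem envToSym_mul_eq_starProd (u v : UniversalEnvelopingAlgebra R L) :
    envToSym R L (u * v) = starProd R L (envToSym R L u) (envToSym R L v) := by
  rw [starProd_envToSym, envToSym_mul]

/-- Both sides agree at `1` and change in the same way under `u ↦ uX`, because `X` is primitive in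
the enveloping algebra and `ρ_X` is a coderivation. -/
theorem comul_envToSym (u : UniversalEnvelopingAlgebra R L) :
    TensorProduct.map (envToSym R L) (envToSym R L) (Coalgebra.comul u) =
      Coalgebra.comul (envToSym R L u) := by
  refine env_submodule_eq_top R L (LinearMap.eqLocus
    (TensorProduct.map (envToSym R L) (envToSym R L) ∘ₗ Coalgebra.comul)
    (Coalgebra.comul ∘ₗ envToSym R L)) ?_ (fun u x hu => ?_) u
  · change TensorProduct.map (envToSym R L) (envToSym R L) (Coalgebra.comul 1) =
      Coalgebra.comul (envToSym R L 1)
    rw [envToSym_one, Bialgebra.comul_one, Bialgebra.comul_one, Algebra.TensorProduct.one_def,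
      Algebra.TensorProduct.one_def, TensorProduct.map_tmul, envToSym_one]
  · change TensorProduct.map (envToSym R L) (envToSym R L) (Coalgebra.comul u) =
      Coalgebra.comul (envToSym R L u) at hu
    change TensorProduct.map (envToSym R L) (envToSym R L)
      (Coalgebra.comul (u * UniversalEnvelopingAlgebra.ι R x)) =
      Coalgebra.comul (envToSym R L (u * UniversalEnvelopingAlgebra.ι R x))
    rw [envToSym_mul_ι, comul_starRight, ← hu, Bialgebra.comul_mul, env_comul_ι]
    generalize Coalgebra.comul (R := R) u = s
    induction s with
    | zero => simp
    | add s s' h h' => simp only [add_mul, map_add] at h h' ⊢; rw [h, h']; abel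
    | tmul a b =>
      simp only [mul_add, Algebra.TensorProduct.tmul_mul_tmul, mul_one, map_add,
        TensorProduct.map_tmul, envToSym_mul_ι, LinearMap.rTensor_tmul, LinearMap.lTensor_tmul]

theorem counit_envToSym (u : UniversalEnvelopingAlgebra R L) :
    Coalgebra.counit (R := R) (envToSym R L u) = Coalgebra.counit (R := R) u := by
  refine env_submodule_eq_top R L (LinearMap.eqLocus
    (Coalgebra.counit (R := R) ∘ₗ envToSym R L) (Coalgebra.counit (R := R))) ?_
    (fun u x hu => ?_) u
  · change Coalgebra.counit (R := R) (envToSym R L 1) = Coalgebra.counit (R := R) 1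
    rw [envToSym_one, Bialgebra.counit_one, Bialgebra.counit_one]
  · change Coalgebra.counit (R := R) (envToSym R L _) = Coalgebra.counit (R := R) _
    rw [envToSym_mul_ι, counit_starRight, Bialgebra.counit_mul, env_counit_ι, mul_zero]

/-! ### The inverse map -/

/-- `(X, B) ↦ f B X - f (B ∘ X)`, the right-hand side of the recursion for the inverse of
`envToSym`. -/
def envStep (f : SymmetricAlgebra R L →ₗ[R] UniversalEnvelopingAlgebra R L) :
    L →ₗ[R] SymmetricAlgebra R L →ₗ[R] UniversalEnvelopingAlgebra R L where
  toFun x := LinearMap.mulRight R (UniversalEnvelopingAlgebra.ι R x) ∘ₗ f -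
    f ∘ₗ (rightAct R L x).toLinearMap
  map_add' x y := by
    ext B; simp [mul_add, -UniversalEnvelopingAlgebra.ι_apply]; abel
  map_smul' r x := by
    ext B; simp [smul_sub, -UniversalEnvelopingAlgebra.ι_apply]

variable {R L} in
theorem envStep_apply (f : SymmetricAlgebra R L →ₗ[R] UniversalEnvelopingAlgebra R L) (x : L)
    (B : SymmetricAlgebra R L) :
    envStep R L f x B = f B * UniversalEnvelopingAlgebra.ι R x - f (rightAct R L x B) := rfl

/-- The condition under which `BX ↦ envStep f X B` does not depend on the order of the letters. -/
def EnvAdmissible (f : SymmetricAlgebra R L →ₗ[R] UniversalEnvelopingAlgebra R L) : Prop :=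
  ∀ x y B, envStep R L f x (SymmetricAlgebra.ι R L y * B) =
    envStep R L f y (SymmetricAlgebra.ι R L x * B)

-- One step already forces admissibility, whatever `f` is. Expanding `f' (YB) X - f' ((YB) ∘ X)`,
-- the mixed terms are symmetric in `X` and `Y`, the term `f B (YX - Y ∘ X)` is symmetric by the
-- bracket relation, and the terms with two letters acting on `B` are symmetric by right symmetry.
variable {R L} in
theorem envAdmissible_of_step
    {f f' : SymmetricAlgebra R L →ₗ[R] UniversalEnvelopingAlgebra R L}
    (h : ∀ x B, f' (SymmetricAlgebra.ι R L x * B) = envStep R L f x B) :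
    EnvAdmissible R L f' := by
  intro x y B
  have hs := congrArg f (rightAct_symm R L x y B)
  have ha : f B * UniversalEnvelopingAlgebra.ι R (x * y - y * x) = f B *
      (UniversalEnvelopingAlgebra.ι R x * UniversalEnvelopingAlgebra.ι R y -
        UniversalEnvelopingAlgebra.ι R y * UniversalEnvelopingAlgebra.ι R x) :=
    congrArg (f B * ·) (LieHom.map_lie (UniversalEnvelopingAlgebra.ι R) x y)
  simp only [map_sub, mul_sub, ← mul_assoc] at hs ha
  simp only [envStep_apply, h, Derivation.leibniz, rightAct_ι, smul_eq_mul, map_add, sub_mul,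
    mul_comm B]
  grind

/-- Approximations of the inverse of `envToSym`, correct on elements of length less than `n`. -/
def symToEnvAux : ℕ →
    {f : SymmetricAlgebra R L →ₗ[R] UniversalEnvelopingAlgebra R L // EnvAdmissible R L f}
  | 0 => ⟨0, fun x y B => by simp [envStep_apply]⟩
  | n + 1 =>
    have h := exists_rec (R := R) (L := L) (1 : UniversalEnvelopingAlgebra R L)
      (envStep R L (symToEnvAux n).1) (symToEnvAux n).2
    ⟨h.choose, envAdmissible_of_step h.choose_spec.2⟩

theorem symToEnvAux_succ_one (n : ℕ) : (symToEnvAux R L (n + 1)).1 1 = 1 :=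
  (exists_rec (R := R) (L := L) (1 : UniversalEnvelopingAlgebra R L)
    (envStep R L (symToEnvAux R L n).1) (symToEnvAux R L n).2).choose_spec.1

theorem symToEnvAux_succ_mul (n : ℕ) (x : L) (B : SymmetricAlgebra R L) :
    (symToEnvAux R L (n + 1)).1 (SymmetricAlgebra.ι R L x * B) =
      envStep R L (symToEnvAux R L n).1 x B :=
  (exists_rec (R := R) (L := L) (1 : UniversalEnvelopingAlgebra R L)
    (envStep R L (symToEnvAux R L n).1) (symToEnvAux R L n).2).choose_spec.2 x B

/-- The approximations stabilise: each step of the recursion strips one letter and lowers the index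
by one, while `B ∘ X` is no longer than `B`. -/
theorem symToEnvAux_eq (k : ℕ) : ∀ A ∈ lengthLE R L k, ∀ m n, k < m → k < n →
    (symToEnvAux R L m).1 A = (symToEnvAux R L n).1 A := by
  induction k with
  | zero =>
    intro A hA m n hm hn
    obtain ⟨r, rfl⟩ := Submodule.mem_span_singleton.1 hA
    obtain ⟨m, rfl⟩ := Nat.exists_eq_succ_of_ne_zero hm.ne'
    obtain ⟨n, rfl⟩ := Nat.exists_eq_succ_of_ne_zero hn.ne'
    rw [map_smul, map_smul, symToEnvAux_succ_one, symToEnvAux_succ_one]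
  | succ k ih =>
    intro A hA m n hm hn
    revert A
    change lengthLE R L (k + 1) ≤ LinearMap.eqLocus (symToEnvAux R L m).1 (symToEnvAux R L n).1
    refine sup_le (fun A hA => ih A hA m n (by lia) (by lia)) (Submodule.span_le.2 ?_)
    rintro _ ⟨x, B, hB, rfl⟩
    obtain ⟨m, rfl⟩ := Nat.exists_eq_succ_of_ne_zero (show m ≠ 0 by lia)
    obtain ⟨n, rfl⟩ := Nat.exists_eq_succ_of_ne_zero (show n ≠ 0 by lia)
    change (symToEnvAux R L (m + 1)).1 _ = (symToEnvAux R L (n + 1)).1 _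
    rw [symToEnvAux_succ_mul, symToEnvAux_succ_mul, envStep_apply, envStep_apply,
      ih B hB m n (by lia) (by lia),
      ih _ (rightAct_mem_lengthLE R L x k B hB) m n (by lia) (by lia)]

/-- There is a linear map with `1 ↦ 1` and `BX ↦ f B X - f (B ∘ X)`. -/
theorem exists_symToEnv : ∃ f : SymmetricAlgebra R L →ₗ[R] UniversalEnvelopingAlgebra R L,
    f 1 = 1 ∧ ∀ x B, f (SymmetricAlgebra.ι R L x * B) = envStep R L f x B := by
  choose k hk using exists_mem_lengthLE R L
  have hf : ∀ A n, k A < n →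
      (symToEnvAux R L (k A + 1)).1 A = (symToEnvAux R L n).1 A :=
    fun A n hn => symToEnvAux_eq R L (k A) A (hk A) _ n (by lia) hn
  obtain ⟨f, hf'⟩ : ∃ f : SymmetricAlgebra R L →ₗ[R] UniversalEnvelopingAlgebra R L,
      ∀ A n, k A < n → f A = (symToEnvAux R L n).1 A :=
    ⟨{ toFun := fun A => (symToEnvAux R L (k A + 1)).1 A
       map_add' := fun A B => by
        -- `k` is an arbitrary choice of length bounds, so the sum of the bounds plus one serves as
        -- a common index at which the approximation is linear.
        rw [hf (A + B) (k (A + B) + k A + k B + 1) (by lia),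
          hf A (k (A + B) + k A + k B + 1) (by lia), hf B (k (A + B) + k A + k B + 1) (by lia),
          map_add]
       map_smul' := fun r A => by
        rw [hf (r • A) (k (r • A) + k A + 1) (by lia), hf A (k (r • A) + k A + 1) (by lia),
          map_smul, RingHom.id_apply] }, hf⟩
  refine ⟨f, ?_, fun x B => ?_⟩
  · rw [hf' 1 (k 1 + 1) (by lia), symToEnvAux_succ_one]
  · generalize hn : k (SymmetricAlgebra.ι R L x * B) + k B + k (rightAct R L x B) + 1 = n
    rw [hf' _ (n + 1) (by lia), symToEnvAux_succ_mul, envStep_apply, envStep_apply,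
      hf' B n (by lia), hf' _ n (by lia)]

/-! ### Bijectivity -/

theorem envToSym_injective : Function.Injective (envToSym R L) := by
  obtain ⟨f, h1, hf⟩ := exists_symToEnv R L
  have h : ∀ x A, f (starRight R L x A) = f A * UniversalEnvelopingAlgebra.ι R x := by
    intro x A
    rw [starRight_apply, map_add, hf, envStep_apply, sub_add_cancel]
  -- By `h`, `f` turns `ρ_X` into right multiplication by `X`, so the composite fixes `1` and
  -- commutes with right multiplication by letters.
  have hinv : ∀ u, f (envToSym R L u) = u := by
    refine env_submodule_eq_top R L (LinearMap.eqLocus (f ∘ₗ envToSym R L) LinearMap.id) ?_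
      (fun u x hu => ?_)
    · change f (envToSym R L 1) = 1
      rw [envToSym_one, h1]
    · change f (envToSym R L u) = u at hu
      change f (envToSym R L _) = _
      rw [envToSym_mul_ι, h, hu]
      rfl
  exact Function.LeftInverse.injective hinv

theorem envToSym_surjective : Function.Surjective (envToSym R L) := by
  have key : ∀ k, lengthLE R L k ≤ LinearMap.range (envToSym R L) := by
    intro k
    induction k with
    | zero => exact (Submodule.span_singleton_le_iff_mem _ _).2 ⟨1, envToSym_one R L⟩
    | succ k ih =>
      refine sup_le ih (Submodule.span_le.2 ?_)
      rintro _ ⟨x, B, hB, rfl⟩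
      obtain ⟨u, hu⟩ := ih hB
      obtain ⟨v, hv⟩ := ih (rightAct_mem_lengthLE R L x k B hB)
      -- The preimage comes from `XB = ρ_X B - B ∘ X`.
      refine ⟨u * UniversalEnvelopingAlgebra.ι R x - v, ?_⟩
      rw [map_sub, envToSym_mul_ι, hu, hv, starRight_apply, add_sub_cancel_right]
  intro A
  obtain ⟨k, hk⟩ := exists_mem_lengthLE R L A
  exact key k hk

/-- The isomorphism of coalgebras from the enveloping algebra to `S(L)`. -/
def envEquivSym : UniversalEnvelopingAlgebra R L ≃ₗc[R] SymmetricAlgebra R L :=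
  CoalgEquiv.ofBijective
    (f := { toLinearMap := envToSym R L
            counit_comp := LinearMap.ext (counit_envToSym R L)
            map_comp_comul := LinearMap.ext (comul_envToSym R L) })
    ⟨envToSym_injective R L, envToSym_surjective R L⟩

end Circ

/-! ### Transport of the Hopf structure -/

/-- A Hopf algebra structure transported along a bijective coalgebra morphism that carries the
product to a given bilinear product. -/
theorem isHopfAlgebra_of_coalgEquiv {R H A : Type*} [CommRing R] [Ring H] [HopfAlgebra R H]
    [AddCommGroup A] [Module R A] [Coalgebra R A] (e : H ≃ₗc[R] A) (mul : A →ₗ[R] A →ₗ[R] A)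
    (hmul : ∀ u v, e (u * v) = mul (e u) (e v)) :
    IsHopfAlgebra mul (e 1)
      (e.toLinearEquiv.toLinearMap ∘ₗ HopfAlgebra.antipode R ∘ₗ
        e.toLinearEquiv.symm.toLinearMap) := by
  have hc : ∀ u, Coalgebra.comul (R := R) (e u) =
      TensorProduct.map e.toLinearEquiv.toLinearMap e.toLinearEquiv.toLinearMap
        (Coalgebra.comul (R := R) u) :=
    fun u => (CoalgHomClass.map_comp_comul_apply e u).symm
  have hε : ∀ u, Coalgebra.counit (R := R) (e u) = Coalgebra.counit (R := R) u :=
    fun u => CoalgHomClass.counit_comp_apply e u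
  -- Replacing the coproduct by an arbitrary tensor `s` allows induction on pure tensors, where the
  -- inner `e⁻¹ e` cancels.
  have hl : ∀ (S : H →ₗ[R] H) (s : H ⊗[R] H),
      TensorProduct.lift mul ((e.toLinearEquiv.toLinearMap ∘ₗ S ∘ₗ
        e.toLinearEquiv.symm.toLinearMap).rTensor A (TensorProduct.map e.toLinearEquiv.toLinearMap
          e.toLinearEquiv.toLinearMap s)) = e (LinearMap.mul' R H (S.rTensor H s)) := by
    intro S s
    induction s with
    | zero => simp
    | add s t hs ht => simp only [map_add, hs, ht]
    | tmul a b => simp [hmul]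
  have hr : ∀ (S : H →ₗ[R] H) (s : H ⊗[R] H),
      TensorProduct.lift mul ((e.toLinearEquiv.toLinearMap ∘ₗ S ∘ₗ
        e.toLinearEquiv.symm.toLinearMap).lTensor A (TensorProduct.map e.toLinearEquiv.toLinearMap
          e.toLinearEquiv.toLinearMap s)) = e (LinearMap.mul' R H (S.lTensor H s)) := by
    intro S s
    induction s with
    | zero => simp
    | add s t hs ht => simp only [map_add, hs, ht]
    | tmul a b => simp [hmul]
  have he : Function.Surjective e := e.toLinearEquiv.surjective
  constructor
  · intro a b c
    obtain ⟨a, rfl⟩ := he a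
    obtain ⟨b, rfl⟩ := he b
    obtain ⟨c, rfl⟩ := he c
    simp only [← hmul, mul_assoc]
  · intro a
    obtain ⟨a, rfl⟩ := he a
    rw [← hmul, one_mul]
  · intro a
    obtain ⟨a, rfl⟩ := he a
    rw [← hmul, mul_one]
  · rw [hε, Bialgebra.counit_one]
  · intro a b
    obtain ⟨a, rfl⟩ := he a
    obtain ⟨b, rfl⟩ := he b
    rw [← hmul, hε, hε, hε, Bialgebra.counit_mul]
  · rw [hc, Bialgebra.comul_one]
    rfl
  · intro a b
    obtain ⟨a, rfl⟩ := he a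
    obtain ⟨b, rfl⟩ := he b
    rw [← hmul, hc, hc, hc, Bialgebra.comul_mul]
    generalize Coalgebra.comul (R := R) a = s
    generalize Coalgebra.comul (R := R) b = t
    induction s with
    | zero => simp
    | add s s' h h' => simp only [add_mul, map_add, LinearMap.add_apply, h, h']
    | tmul a b =>
      induction t with
      | zero => simp
      | add s s' h h' => simp only [mul_add, map_add, h, h']
      | tmul c d => simp [hmul]
  · intro a
    obtain ⟨a, rfl⟩ := he a
    rw [hc, hl, HopfAlgebra.mul_antipode_rTensor_comul_apply, hε, Algebra.algebraMap_eq_smul_one,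
      map_smul]
  · intro a
    obtain ⟨a, rfl⟩ := he a
    rw [hc, hr, HopfAlgebra.mul_antipode_lTensor_comul_apply, hε, Algebra.algebraMap_eq_smul_one,
      map_smul]

end PreLieSym

end

theorem theorem2p11 {R L : Type*} [CommRing R] [RightPreLieRing L] [RightPreLieAlgebra R L] :
    ∃ antipode : SymmetricAlgebra R L →ₗ[R] SymmetricAlgebra R L,
      PreLieSym.IsHopfAlgebra (PreLieSym.starProd R L) 1 antipode ∧
      ∃ φ : UniversalEnvelopingAlgebra R L ≃ₗc[R] SymmetricAlgebra R L,
        φ 1 = 1 ∧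
        (∀ u v, φ (u * v) = PreLieSym.starProd R L (φ u) (φ v)) ∧
        (∀ u, φ (HopfAlgebra.antipode R u) = antipode (φ u)) ∧
        ∀ x : L, φ (UniversalEnvelopingAlgebra.ι R x) = SymmetricAlgebra.ι R L x := by
  have h1 : PreLieSym.envEquivSym R L 1 = 1 := PreLieSym.envToSym_one R L
  have hH := PreLieSym.isHopfAlgebra_of_coalgEquiv (PreLieSym.envEquivSym R L)
    (PreLieSym.starProd R L) (PreLieSym.envToSym_mul_eq_starProd R L)
  rw [h1] at hH
  -- The antipode is the conjugate `φ S φ⁻¹` of that of the enveloping algebra, so `φ` intertwines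
  -- the antipodes by construction.
  refine ⟨_, hH, PreLieSym.envEquivSym R L, h1, PreLieSym.envToSym_mul_eq_starProd R L,
    fun u => ?_, PreLieSym.envToSym_ι R L⟩
  change _ = PreLieSym.envEquivSym R L (HopfAlgebra.antipode R
    ((PreLieSym.envEquivSym R L).toLinearEquiv.symm ((PreLieSym.envEquivSym R L).toLinearEquiv u)))
  rw [LinearEquiv.symm_apply_apply]
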